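/- Let $1<p<n$ be integers, $r>0$ and $M,K\ge 0$. There is a constant $C$ depending only on $n,p,r,M,K$ with the following property. For a symmetric real $n\times n$ matrix $A$ with eigenvalues $\lambda_1,\dots,\lambda_n$ (counted with multiplicity) put $$\mathcal M_p(A)=\prod_{1\le i_1<\dots<i_p\le n}(\lambda_{i_1}+\dots+\lambda_{i_p}),$$ and let $P_p$ be the cone of those symmetric $A$ for which all the sums $\lambda_{i_1}+\dots+\lambda_{i_p}$ ($i_1<\dots<i_p$) are positive. A $C^2$ function $u$ on a domain $\Omega\subset\mathbb R^n$ is called $p$-plurisubharmonic if $D^2u(x)\in\overline{P_p}$ for every $x\in\Omega$; write $\mathcal M_p(u)(x)=\mathcal M_p(D^2u(x))$. Let $x_0\in\mathbb R^n$ and let $u\in C^3(B_r(x_0))\cap C^1(\overline{B_r(x_0)})$ be $p$-plurisubharmonic in $B_r(x_0)$ with $\sup_{B_r(x_0)}|u|\le M$. Suppose that $u$ solves $$\mathcal M_p(u)(x)=f(x,u(x))\qquad\text{in } B_r(x_0),$$ where $f\ge 0$ on $B_r(x_0)\times\mathbb R$ has Lipschitz bound $K$, that is, $|f(x,s)|\le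 K$ and $|f(x,s)-f(y,t)|\le K(|x-y|+|s-t|)$ for all $x,y\in B_r(x_0)$ and $s,t\in\mathbb R$. Then $$|Du(x_0)|\le C .$$ -/

import Mathlib

/-- The Hessian matrix `D²u(x)` of a function `u` on `ℝⁿ`: its `(i, j)` entry is the second
derivative of `u` at `x` in the coordinate directions `i` and `j`. -/
noncomputable def hessian {n : ℕ} (u : EuclideanSpace ℝ (Fin n) → ℝ)
    (x : EuclideanSpace ℝ (Fin n)) : Matrix (Fin n) (Fin n) ℝ :=
  Matrix.of fun i j =>
    fderiv ℝ (fderiv ℝ u) x (EuclideanSpace.single i 1) (EuclideanSpace.single j 1)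

/-- The Hessian of a `C²` function on an open set is symmetric. -/
theorem hessian_isHermitian {n : ℕ} {u : EuclideanSpace ℝ (Fin n) → ℝ}
    {Ω : Set (EuclideanSpace ℝ (Fin n))} (hΩ : IsOpen Ω) (hu : ContDiffOn ℝ 2 u Ω)
    {x : EuclideanSpace ℝ (Fin n)} (hx : x ∈ Ω) : (hessian u x).IsHermitian := by
  have h : IsSymmSndFDerivAt ℝ u x :=
    (hu.contDiffAt (hΩ.mem_nhds hx)).isSymmSndFDerivAt (by simp)
  ext i j
  simpa [hessian] using h (EuclideanSpace.single j 1) (EuclideanSpace.single i 1)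

/-- The cone `P_p` of symmetric `n × n` matrices all of whose sums of `p` eigenvalues
(eigenvalues listed with multiplicity, `p` different indices) are positive. -/
def pCone (n p : ℕ) : Set (Matrix (Fin n) (Fin n) ℝ) :=
  {A | ∃ hA : A.IsHermitian,
    ∀ s ∈ (Finset.univ : Finset (Fin n)).powersetCard p, 0 < ∑ i ∈ s, hA.eigenvalues i}

/-- A function `u` is `p`-plurisubharmonic on a domain `Ω ⊆ ℝⁿ` if it is `C²` there and its
Hessian lies at every point of `Ω` in the closure of the cone `P_p`. -/
structure IsPPlurisubharmonicOn {n : ℕ} (p : ℕ) (u : EuclideanSpace ℝ (Fin n) → ℝ)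
    (Ω : Set (EuclideanSpace ℝ (Fin n))) : Prop where
  contDiffOn : ContDiffOn ℝ 2 u Ω
  hessian_mem : ∀ x ∈ Ω, hessian u x ∈ closure (pCone n p)

open Classical in
/-- The product of all sums `λ_{i₁} + ⋯ + λ_{i_p}`, `i₁ < ⋯ < i_p`, of eigenvalues of a symmetric
matrix `A` (with the irrelevant value `0` if `A` is not symmetric). -/
noncomputable def mpMatrix {n : ℕ} (p : ℕ) (A : Matrix (Fin n) (Fin n) ℝ) : ℝ :=
  if hA : A.IsHermitian then
    ∏ s ∈ (Finset.univ : Finset (Fin n)).powersetCard p, ∑ i ∈ s, hA.eigenvalues i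
  else 0

/-- The operator `𝓜_p(u)` at the point `x`. -/
noncomputable def mpOperator {n : ℕ} (p : ℕ) (u : EuclideanSpace ℝ (Fin n) → ℝ)
    (x : EuclideanSpace ℝ (Fin n)) : ℝ :=
  mpMatrix p (hessian u x)

/-- `f = f(x, s)` has Lipschitz bound `K` on `Ω × ℝ`: it is bounded by `K` and Lipschitz with
constant `K` there. -/
structure HasLipschitzBound {n : ℕ} (f : EuclideanSpace ℝ (Fin n) → ℝ → ℝ)
    (Ω : Set (EuclideanSpace ℝ (Fin n))) (K : ℝ) : Prop where
  bound : ∀ x ∈ Ω, ∀ s : ℝ, |f x s| ≤ K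
  lipschitz : ∀ x ∈ Ω, ∀ y ∈ Ω, ∀ s t : ℝ, |f x s - f y t| ≤ K * (‖x - y‖ + |s - t|)

/-!
Put `w = -log (c - u)` with `c - u ≥ 1`, so that `D²w = (c - u)⁻¹ D²u + Dw ⊗ Dw`. Suppose that
`w x₀ - w y₀ > g ‖x₀ - y₀‖` for the concave modulus `g t = L t - (L t)² / (8 m)`, where `m` bounds
the oscillation of `w`. Then, for a suitable `B`,
`w x - w y - B ‖x - x₀‖² - g ‖x - y‖` has a positive maximum at some interior `(x, y)` with `x ≠ y`,
where the first and second order conditions compare `D²u(x)` with `D²u(y)`.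

Let `e` be the direction of `x - y` and `v₁, …, v_p` orthonormal eigenvectors of `D²u(y)`. If
`∑ ⟪e, vᵢ⟫² ≥ 1 / (2 p)`, displace `x` along the reflections of the `vᵢ` in the hyperplane `e^⊥` and
`y` along the `vᵢ`: the concavity of `g` gives a gain of order `L²`. Otherwise the `vᵢ` are nearly
orthogonal to `e`, the positivity of `D²u(x)` extends to the sum of its values at the `vᵢ` and half
its value at `e`, and the gain of order `L²` comes from `Dw ⊗ Dw` in the direction `e`. In both
cases the eigenvalues of `D²u(y)` at the `vᵢ` have a large sum once `L` is large. As this holds for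
all choices of `p` eigenvectors, `𝓜_p(u)(y)` exceeds its upper bound. Hence `w`, and with it `u`,
has a bounded gradient at `x₀`.
-/

open scoped RealInnerProductSpace
open Filter Topology Metric

section WeightedSums

variable {ι : Type*} [Fintype ι]

theorem exists_card_eq_forall_le {α : Type*} [LinearOrder α] (l : ι → α) {p : ℕ}
    (hp : p ≤ Fintype.card ι) :
    ∃ s : Finset ι, s.card = p ∧ ∀ i ∈ s, ∀ j ∉ s, l i ≤ l j := by
  classical
  induction p with
  | zero => exact ⟨∅, by simp⟩
  | succ p ih =>
    obtain ⟨s, hs, hle⟩ := ih (by lia)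
    have hne : sᶜ.Nonempty := by
      rw [← Finset.card_pos, Finset.card_compl]
      lia
    obtain ⟨k, hk, hmin⟩ := Finset.exists_min_image sᶜ l hne
    refine ⟨insert k s, by rw [Finset.card_insert_of_notMem (by simpa using hk), hs], ?_⟩
    intro i hi j hj
    rw [Finset.mem_insert, not_or] at hj
    rcases Finset.mem_insert.1 hi with rfl | hi
    · exact hmin j (by simpa using hj.2)
    · exact hle i hi j hj.2

/-- Moving mass towards smaller values only decreases the sum, so that `c` can be replaced by the
weights `θ` on the `p` smallest values of `l`. -/
theorem sum_mul_nonneg_of_forall_sum_nonneg {R : Type*} [CommRing R] [LinearOrder R]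
    [IsStrictOrderedRing R] {l c : ι → R} {p : ℕ} {θ : R} (hp : p ≠ 0)
    (hpι : p ≤ Fintype.card ι) (hl : ∀ s : Finset ι, s.card = p → 0 ≤ ∑ i ∈ s, l i)
    (hc : ∀ i, c i ∈ Set.Icc 0 θ) (hsum : ∑ i, c i = p * θ) : 0 ≤ ∑ i, c i * l i := by
  classical
  obtain ⟨s, hs, hle⟩ := exists_card_eq_forall_le l hpι
  obtain ⟨k, hk, hmax⟩ := s.exists_max_image l (Finset.card_ne_zero.1 (hs ▸ hp))
  have hθ : 0 ≤ θ := (hc k).1.trans (hc k).2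
  have hterm : ∀ i, 0 ≤ (c i - if i ∈ s then θ else 0) * (l i - l k) := by
    intro i
    split_ifs with hi
    · exact mul_nonneg_of_nonpos_of_nonpos (sub_nonpos.2 (hc i).2) (sub_nonpos.2 (hmax i hi))
    · exact mul_nonneg (by simpa using (hc i).1) (sub_nonneg.2 (hle k hk i hi))
  have hmass : ∑ i, (c i - if i ∈ s then θ else 0) = 0 := by
    simp [Finset.sum_sub_distrib, hsum, hs]
  have hexpand : ∑ i, (c i - if i ∈ s then θ else 0) * (l i - l k)
      = ∑ i, c i * l i - θ * ∑ i ∈ s, l i := by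
    simp_rw [mul_sub _ (l _)]
    rw [Finset.sum_sub_distrib, ← Finset.sum_mul, hmass]
    simp [sub_mul, Finset.sum_sub_distrib, Finset.mul_sum]
  have hgap : 0 ≤ ∑ i, (c i - if i ∈ s then θ else 0) * (l i - l k) :=
    Finset.sum_nonneg fun i _ => hterm i
  linarith [mul_nonneg hθ (hl s hs)]

end WeightedSums

section QuadForm

variable {ι : Type*} [Fintype ι] [DecidableEq ι]

/-- The quadratic form `ξ ↦ ⟪ξ, A ξ⟫` of a real matrix, as a function on Euclidean space. -/
noncomputable def quadForm (A : Matrix ι ι ℝ) (ξ : EuclideanSpace ℝ ι) : ℝ :=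
  ⟪ξ, Matrix.toEuclideanLin A ξ⟫

theorem quadForm_eq_sum (A : Matrix ι ι ℝ) (ξ : EuclideanSpace ℝ ι) :
    quadForm A ξ = ∑ i, ∑ j, ξ i * ξ j * A i j := by
  simp only [quadForm, Matrix.toLpLin_apply, PiLp.inner_apply, Matrix.mulVec, dotProduct,
    RCLike.inner_apply, conj_trivial, Finset.sum_mul]
  exact Finset.sum_congr rfl fun i _ => Finset.sum_congr rfl fun j _ => by ring

theorem continuous_quadForm (ξ : EuclideanSpace ℝ ι) :
    Continuous fun A : Matrix ι ι ℝ => quadForm A ξ := by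
  simp only [quadForm_eq_sum]
  fun_prop

theorem toEuclideanLin_eigenvectorBasis {A : Matrix ι ι ℝ} (hA : A.IsHermitian) (i : ι) :
    Matrix.toEuclideanLin A (hA.eigenvectorBasis i)
      = hA.eigenvalues i • hA.eigenvectorBasis i := by
  ext j
  simpa [Matrix.toLpLin_apply] using congrFun (hA.mulVec_eigenvectorBasis i) j

theorem quadForm_eigenvectorBasis {A : Matrix ι ι ℝ} (hA : A.IsHermitian) (i : ι) :
    quadForm A (hA.eigenvectorBasis i) = hA.eigenvalues i := by
  simp [quadForm, toEuclideanLin_eigenvectorBasis, real_inner_smul_right]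

theorem quadForm_eq_sum_eigenvalues {A : Matrix ι ι ℝ} (hA : A.IsHermitian)
    (ξ : EuclideanSpace ℝ ι) :
    quadForm A ξ = ∑ j, ⟪ξ, hA.eigenvectorBasis j⟫ ^ 2 * hA.eigenvalues j := by
  rw [quadForm, ← hA.eigenvectorBasis.sum_inner_mul_inner]
  refine Finset.sum_congr rfl fun j _ => ?_
  rw [← Matrix.isSymmetric_toEuclideanLin_iff.mpr hA, toEuclideanLin_eigenvectorBasis,
    real_inner_smul_left, real_inner_comm ξ]
  ring

/-- For `T = ∑ k, c k • ξ k ⊗ ξ k` the hypotheses say `0 ≤ T ≤ θ` and `tr T = p θ`, and the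
conclusion is `0 ≤ tr (A T)`. -/
theorem sum_mul_quadForm_nonneg_of_eigenvalues {κ : Type*} [Fintype κ] {A : Matrix ι ι ℝ}
    (hA : A.IsHermitian) {p : ℕ} (hp : p ≠ 0) (hpι : p ≤ Fintype.card ι)
    (hpos : ∀ s : Finset ι, s.card = p → 0 ≤ ∑ i ∈ s, hA.eigenvalues i)
    {ξ : κ → EuclideanSpace ℝ ι} {c : κ → ℝ} {θ : ℝ} (hc : ∀ k, 0 ≤ c k)
    (hbound : ∀ z, ∑ k, c k * ⟪ξ k, z⟫ ^ 2 ≤ θ * ‖z‖ ^ 2)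
    (htrace : ∑ k, c k * ‖ξ k‖ ^ 2 = p * θ) : 0 ≤ ∑ k, c k * quadForm A (ξ k) := by
  set v := hA.eigenvectorBasis
  have hweights : ∀ j, ∑ k, c k * ⟪ξ k, v j⟫ ^ 2 ∈ Set.Icc 0 θ := fun j =>
    ⟨Finset.sum_nonneg fun k _ => mul_nonneg (hc k) (sq_nonneg _), by simpa using hbound (v j)⟩
  have hmass : ∑ j, ∑ k, c k * ⟪ξ k, v j⟫ ^ 2 = p * θ := by
    rw [Finset.sum_comm, ← htrace]
    simp only [← Finset.mul_sum, v.sum_sq_inner_left]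
  calc 0 ≤ ∑ j, (∑ k, c k * ⟪ξ k, v j⟫ ^ 2) * hA.eigenvalues j :=
        sum_mul_nonneg_of_forall_sum_nonneg hp hpι hpos hweights hmass
    _ = ∑ k, c k * quadForm A (ξ k) := by
        simp only [quadForm_eq_sum_eigenvalues hA, Finset.sum_mul, Finset.mul_sum, mul_assoc]
        exact Finset.sum_comm

end QuadForm

section Orthonormal

variable {E : Type*} [NormedAddCommGroup E] [InnerProductSpace ℝ E]
  {ι : Type*} [Fintype ι] {v : ι → E}

theorem sum_inner_sq_le (hv : Orthonormal ℝ v) (z : E) : ∑ i, ⟪v i, z⟫ ^ 2 ≤ ‖z‖ ^ 2 := by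
  simpa using hv.sum_inner_products_le (s := Finset.univ) z

/-- If `P` is the projection onto the span of `v`, then `⟪e, z⟫` is the sum of `⟪P e, P z⟫` and
`⟪e, z - P z⟫`, and the square of a sum is at most twice the sum of the squares. -/
theorem sum_inner_sq_add_half_inner_sq_le (hv : Orthonormal ℝ v) {e : E} (he : ‖e‖ = 1)
    (z : E) :
    ∑ i, ⟪v i, z⟫ ^ 2 + 1 / 2 * ⟪e, z⟫ ^ 2 ≤ (1 + ∑ i, ⟪e, v i⟫ ^ 2) * ‖z‖ ^ 2 := by
  set w := z - ∑ i, ⟪v i, z⟫ • v i with hw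
  have hsplit : ⟪e, z⟫ = ∑ i, ⟪e, v i⟫ * ⟪v i, z⟫ + ⟪e, w⟫ := by
    simp [hw, inner_sub_right, inner_sum, real_inner_smul_right, mul_comm]
  have hortho : ⟪∑ i, ⟪v i, z⟫ • v i, z⟫ = ∑ i, ⟪v i, z⟫ ^ 2 := by
    simp [sum_inner, real_inner_smul_left, sq]
  have hnormP : ‖∑ i, ⟪v i, z⟫ • v i‖ ^ 2 = ∑ i, ⟪v i, z⟫ ^ 2 := by
    rw [← real_inner_self_eq_norm_sq, hv.inner_sum]
    simp [sq]
  have hnormw : ‖w‖ ^ 2 = ‖z‖ ^ 2 - ∑ i, ⟪v i, z⟫ ^ 2 := by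
    rw [hw, norm_sub_sq_real, real_inner_comm, hortho, hnormP]
    ring
  have hin : (∑ i, ⟪e, v i⟫ * ⟪v i, z⟫) ^ 2 ≤ (∑ i, ⟪e, v i⟫ ^ 2) * ‖z‖ ^ 2 :=
    (Finset.sum_mul_sq_le_sq_mul_sq _ _ _).trans <|
      mul_le_mul_of_nonneg_left (sum_inner_sq_le hv z) (Finset.sum_nonneg fun _ _ => sq_nonneg _)
  have hout : ⟪e, w⟫ ^ 2 ≤ ‖w‖ ^ 2 := by
    simpa [he, sq_abs] using pow_le_pow_left₀ (abs_nonneg _) (abs_real_inner_le_norm e w) 2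
  rw [hsplit]
  linarith [add_sq_le (a := ∑ i, ⟪e, v i⟫ * ⟪v i, z⟫) (b := ⟪e, w⟫)]

end Orthonormal

section ClosedCone

variable {n p : ℕ} {A : Matrix (Fin n) (Fin n) ℝ} {κ : Type*} [Fintype κ]

theorem sum_mul_quadForm_nonneg (hp : p ≠ 0) (hpn : p ≤ n) (hA : A ∈ closure (pCone n p))
    {ξ : κ → EuclideanSpace ℝ (Fin n)} {c : κ → ℝ} {θ : ℝ} (hc : ∀ k, 0 ≤ c k)
    (hbound : ∀ z, ∑ k, c k * ⟪ξ k, z⟫ ^ 2 ≤ θ * ‖z‖ ^ 2)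
    (htrace : ∑ k, c k * ‖ξ k‖ ^ 2 = p * θ) : 0 ≤ ∑ k, c k * quadForm A (ξ k) := by
  have hclosed : IsClosed {A : Matrix (Fin n) (Fin n) ℝ | 0 ≤ ∑ k, c k * quadForm A (ξ k)} :=
    isClosed_le continuous_const
      (continuous_finsetSum _ fun k _ => continuous_const.mul (continuous_quadForm (ξ k)))
  refine closure_minimal ?_ hclosed hA
  rintro A ⟨hH, hpos⟩
  refine sum_mul_quadForm_nonneg_of_eigenvalues hH hp (by simpa using hpn)
    (fun s hs => (hpos s ?_).le) hc hbound htrace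
  exact Finset.mem_powersetCard.2 ⟨Finset.subset_univ s, hs⟩

variable {v : κ → EuclideanSpace ℝ (Fin n)}

theorem sum_quadForm_nonneg (hp : p ≠ 0) (hpn : p ≤ n) (hA : A ∈ closure (pCone n p))
    (hv : Orthonormal ℝ v) (hκ : Fintype.card κ = p) : 0 ≤ ∑ k, quadForm A (v k) := by
  simpa using sum_mul_quadForm_nonneg hp hpn hA (ξ := v) (c := 1) (θ := 1) (by simp)
    (fun z => by simpa using sum_inner_sq_le hv z) (by simp [hv.1, hκ])

theorem sum_quadForm_add_half_nonneg (hp : p ≠ 0) (hpn : p ≤ n) (hA : A ∈ closure (pCone n p))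
    (hv : Orthonormal ℝ v) (hκ : Fintype.card κ = p) {e : EuclideanSpace ℝ (Fin n)}
    (he : ‖e‖ = 1) (hev : ∑ k, ⟪e, v k⟫ ^ 2 ≤ 1 / (2 * p)) :
    0 ≤ ∑ k, quadForm A (v k) + 1 / 2 * quadForm A e := by
  have h := sum_mul_quadForm_nonneg hp hpn hA (ξ := fun o : Option κ => o.elim e v)
    (c := fun o => o.elim (1 / 2) 1) (θ := 1 + 1 / (2 * p))
    (by rintro (_ | _) <;> simp)
    (fun z => by
      have hz := sum_inner_sq_add_half_inner_sq_le hv he z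
      have hθ := mul_le_mul_of_nonneg_right (add_le_add_right hev 1) (sq_nonneg ‖z‖)
      simpa [Fintype.sum_option, add_comm] using hz.trans hθ)
    (by
      simp only [Fintype.sum_option, Option.elim, he, hv.1, Pi.one_apply, one_pow, mul_one,
        Finset.sum_const, Finset.card_univ, hκ, nsmul_eq_mul]
      field_simp
      ring)
  simpa [Fintype.sum_option, add_comm] using h

end ClosedCone

section Comparison

variable {E : Type*} [NormedAddCommGroup E] [InnerProductSpace ℝ E]

/-- The relation between the second order jets of two functions `w₁` and `w₂` at an interior
maximum point `(x, y)` of `w₁ x - w₂ y - g ‖x - y‖ - B ‖x - x₀‖ ^ 2`. Here `e` is the direction of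
`x - y`, `F = -g'' ‖x - y‖`, the gradients of `w₁` and `w₂` are `q • e + b` and `q • e`, and the
Hessians of `w₁` and `w₂` are `X` and `Y` plus the squares of the gradients, as for logarithms. -/
def DoublingComparison (X Y : E → ℝ) (e b : E) (q F B : ℝ) : Prop :=
  ∀ (τ : ℝ) (ξ η : E), ξ - η = τ • e →
    X ξ + ⟪q • e + b, ξ⟫ ^ 2 + F * τ ^ 2 - 2 * B * ‖ξ‖ ^ 2 ≤ Y η + ⟪q • e, η⟫ ^ 2

namespace DoublingComparison

variable {X Y : E → ℝ} {e b : E} {q F B : ℝ} {ι : Type*} [Fintype ι] {v : ι → E}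

theorem le_of_inner_sq_eq (h : DoublingComparison X Y e b q F B) (hq : 0 ≤ q) (he : ‖e‖ = 1)
    {τ : ℝ} {ξ η : E} (hτ : ξ - η = τ • e) (hξ : ‖ξ‖ = 1) (hinner : ⟪e, ξ⟫ ^ 2 = ⟪e, η⟫ ^ 2) :
    X ξ + F * τ ^ 2 - 2 * (q * ‖b‖ + B) ≤ Y η := by
  have heξ : |⟪e, ξ⟫| ≤ 1 := by simpa [he, hξ] using abs_real_inner_le_norm e ξ
  have hbξ : |⟪b, ξ⟫| ≤ ‖b‖ := by simpa [hξ] using abs_real_inner_le_norm b ξ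
  have hcross : -(q * ‖b‖) ≤ q * (⟪e, ξ⟫ * ⟪b, ξ⟫) := by
    rw [← mul_neg]
    refine mul_le_mul_of_nonneg_left (abs_le.1 ?_).1 hq
    rw [abs_mul]
    exact (mul_le_mul heξ hbξ (abs_nonneg _) zero_le_one).trans_eq (one_mul _)
  have hgrad : ⟪q • e, η⟫ ^ 2 - 2 * (q * ‖b‖) ≤ ⟪q • e + b, ξ⟫ ^ 2 := by
    rw [inner_add_left, real_inner_smul_left, real_inner_smul_left, mul_pow, ← hinner]
    linarith [sq_nonneg ⟪b, ξ⟫]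
  have hcmp := h τ ξ η hτ
  rw [hξ] at hcmp
  linarith

/-- The comparison in the pairs `(v i', v i)`, where `v i'` is the mirror image of `v i` in the
hyperplane orthogonal to `e`: these are the pairs which see the concavity `F` of `g`. -/
theorem sum_reflection_le (h : DoublingComparison X Y e b q F B) (hq : 0 ≤ q) (he : ‖e‖ = 1)
    (hv : ∀ i, ‖v i‖ = 1) :
    ∑ i, X ((ℝ ∙ e)ᗮ.reflection (v i)) + 4 * F * ∑ i, ⟪e, v i⟫ ^ 2
      - 2 * Fintype.card ι * (q * ‖b‖ + B) ≤ ∑ i, Y (v i) := by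
  have hterm : ∀ i, X ((ℝ ∙ e)ᗮ.reflection (v i)) + 4 * F * ⟪e, v i⟫ ^ 2
      - 2 * (q * ‖b‖ + B) ≤ Y (v i) := fun i => by
    have hrefl : (ℝ ∙ e)ᗮ.reflection (v i) = v i + (-(2 * ⟪e, v i⟫)) • e := by
      rw [Submodule.reflection_orthogonal_apply, Submodule.reflection_singleton_apply, he]
      simp only [RCLike.ofReal_real_eq_id, id_eq, one_pow, div_one]
      module
    have hinner : ⟪e, (ℝ ∙ e)ᗮ.reflection (v i)⟫ ^ 2 = ⟪e, v i⟫ ^ 2 := by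
      rw [hrefl, inner_add_right, real_inner_smul_right, real_inner_self_eq_norm_sq, he]
      ring
    have hcmp := h.le_of_inner_sq_eq hq he (sub_eq_iff_eq_add'.2 hrefl)
      (by simp [hv i]) hinner
    linarith
  simpa [Finset.sum_sub_distrib, Finset.sum_add_distrib, ← Finset.mul_sum, mul_left_comm,
    mul_assoc] using Finset.sum_le_sum fun i (_ : i ∈ Finset.univ) => hterm i

/-- If `v` is nearly orthogonal to `e`, then positivity of `X` also controls `X e`, and the
comparison in the pair `(e, 0)` bounds `X e` from above by `-q ^ 2`. -/
theorem sum_transversal_le (h : DoublingComparison X Y e b q F B) (hq : 0 ≤ q) (hF : 0 ≤ F)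
    (he : ‖e‖ = 1) (hv : ∀ i, ‖v i‖ = 1) (hY : Y 0 = 0)
    (hX : 0 ≤ ∑ i, X (v i) + 1 / 2 * X e) :
    q ^ 2 / 2 - (q * ‖b‖ + B) - 2 * Fintype.card ι * (q * ‖b‖ + B) ≤ ∑ i, Y (v i) := by
  have hdiag : ∑ i, X (v i) - 2 * Fintype.card ι * (q * ‖b‖ + B) ≤ ∑ i, Y (v i) := by
    have hterm : ∀ i, X (v i) - 2 * (q * ‖b‖ + B) ≤ Y (v i) := fun i => by
      simpa using h.le_of_inner_sq_eq hq he (τ := 0) (by simp) (hv i) rfl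
    simpa [Finset.sum_sub_distrib, mul_left_comm, mul_assoc] using
      Finset.sum_le_sum fun i (_ : i ∈ Finset.univ) => hterm i
  have hnormal : X e + (q + ⟪b, e⟫) ^ 2 + F - 2 * B ≤ 0 := by
    simpa [inner_add_left, real_inner_smul_left, he, hY] using h 1 e 0 (by simp)
  have hbe : |⟪b, e⟫| ≤ ‖b‖ := by simpa [he] using abs_real_inner_le_norm b e
  have hcross : -(q * ‖b‖) ≤ q * ⟪b, e⟫ := by
    rw [← mul_neg]
    exact mul_le_mul_of_nonneg_left (abs_le.1 hbe).1 hq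
  linarith [sq_nonneg ⟪b, e⟫]

/-- The sum of the `⟪e, v i⟫ ^ 2` decides whether the concavity `F` of the penalty or the square
`q ^ 2` of its slope is used. -/
theorem le_sum_of_mem_closure_pCone {n p : ℕ} (hp : p ≠ 0) (hpn : p ≤ n)
    {A : Matrix (Fin n) (Fin n) ℝ} (hA : A ∈ closure (pCone n p)) {d : ℝ} (hd : 0 ≤ d)
    {Y : EuclideanSpace ℝ (Fin n) → ℝ} {e b : EuclideanSpace ℝ (Fin n)}
    (h : DoublingComparison (fun ξ => d * quadForm A ξ) Y e b q F B) (hq : 0 ≤ q) (hF : 0 ≤ F)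
    (he : ‖e‖ = 1) (hY : Y 0 = 0) {v : ι → EuclideanSpace ℝ (Fin n)} (hv : Orthonormal ℝ v)
    (hι : Fintype.card ι = p) {k : ℝ} (hkF : k + 2 * p * (q * ‖b‖ + B) ≤ 2 * F / p)
    (hkq : k + (2 * p + 1) * (q * ‖b‖ + B) ≤ q ^ 2 / 2) : k ≤ ∑ i, Y (v i) := by
  rcases le_total (∑ i, ⟪e, v i⟫ ^ 2) (1 / (2 * p)) with hsmall | hlarge
  · have hX : 0 ≤ ∑ i, d * quadForm A (v i) + 1 / 2 * (d * quadForm A e) := by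
      have hcone := mul_nonneg hd (sum_quadForm_add_half_nonneg hp hpn hA hv hι he hsmall)
      rw [mul_add, Finset.mul_sum] at hcone
      linarith
    have hsum := h.sum_transversal_le hq hF he hv.1 hY hX
    rw [hι] at hsum
    linarith
  · have hX : 0 ≤ ∑ i, d * quadForm A ((ℝ ∙ e)ᗮ.reflection (v i)) := by
      rw [← Finset.mul_sum]
      exact mul_nonneg hd (sum_quadForm_nonneg hp hpn hA
        (hv.comp_linearIsometryEquiv (ℝ ∙ e)ᗮ.reflection) hι)
    have hsum := h.sum_reflection_le hq he hv.1
    have hconcave : 2 * F / p ≤ 4 * F * ∑ i, ⟪e, v i⟫ ^ 2 := by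
      calc 2 * F / p = 4 * F * (1 / (2 * p)) := by ring
        _ ≤ _ := by gcongr
    rw [hι] at hsum
    linarith

end DoublingComparison

end Comparison

section SecondDerivative

theorem hasDerivAt_deriv_nonpos_of_isLocalMax {f f' : ℝ → ℝ} {a c : ℝ} (h : IsLocalMax f a)
    (hf : ∀ᶠ t in 𝓝 a, HasDerivAt f (f' t) t) (hf' : HasDerivAt f' c a) : c ≤ 0 := by
  have hderiv : deriv f =ᶠ[𝓝 a] f' := hf.mono fun _ ht => ht.deriv
  have hderiv₂ : deriv (deriv f) a = c := hderiv.deriv_eq.trans hf'.deriv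
  by_contra! hc
  have hmin : IsLocalMin f a :=
    isLocalMin_of_deriv_deriv_pos (hderiv₂ ▸ hc) h.deriv_eq_zero hf.self_of_nhds.continuousAt
  have hconst : f =ᶠ[𝓝 a] fun _ => f a :=
    (h.and hmin).mono fun _ ht => le_antisymm ht.1 ht.2
  have hzero : deriv (deriv f) a = 0 := by simpa using hconst.deriv.deriv_eq
  exact hc.ne' (hderiv₂.symm.trans hzero)

variable {E : Type*} [NormedAddCommGroup E] [NormedSpace ℝ E]

theorem hasDerivAt_add_smul (z ξ : E) (s : ℝ) : HasDerivAt (fun s : ℝ => z + s • ξ) ξ s := by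
  simpa using ((hasDerivAt_id s).smul_const ξ).const_add z

theorem eventually_hasDerivAt_comp_add_smul {w : E → ℝ} {z : E} (hw : ContDiffAt ℝ 2 w z)
    (ξ : E) : ∀ᶠ s in 𝓝 (0 : ℝ),
      HasDerivAt (fun s : ℝ => w (z + s • ξ)) (fderiv ℝ w (z + s • ξ) ξ) s := by
  have hline : Tendsto (fun s : ℝ => z + s • ξ) (𝓝 0) (𝓝 z) := by
    simpa using (hasDerivAt_add_smul z ξ 0).continuousAt.tendsto
  filter_upwards [hline.eventually (hw.eventually (by simp))] with s hs
  exact (hs.differentiableAt (by simp)).hasFDerivAt.comp_hasDerivAt s (hasDerivAt_add_smul z ξ s)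

theorem hasDerivAt_fderiv_comp_add_smul {w : E → ℝ} {z : E} (hw : ContDiffAt ℝ 2 w z) (ξ : E) :
    HasDerivAt (fun s : ℝ => fderiv ℝ w (z + s • ξ) ξ) (fderiv ℝ (fderiv ℝ w) z ξ ξ) 0 := by
  have hfderiv : HasFDerivAt (fderiv ℝ w) (fderiv ℝ (fderiv ℝ w) z) (z + (0 : ℝ) • ξ) := by
    simpa using ((hw.fderiv_right (m := 1) le_rfl).differentiableAt (by simp)).hasFDerivAt
  exact (ContinuousLinearMap.apply ℝ ℝ ξ).hasFDerivAt.comp_hasDerivAt 0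
    (hfderiv.comp_hasDerivAt 0 (hasDerivAt_add_smul z ξ 0))

end SecondDerivative

section Doubling

variable {E : Type*} [NormedAddCommGroup E]

/-- The function `(x, y) ↦ w₁ x - w₂ y - g ‖x - y‖` on pairs of points, which measures the
increments of `w₁` and `w₂` against the modulus of continuity `g`. -/
def doubling (w₁ w₂ : E → ℝ) (g : ℝ → ℝ) (z : E × E) : ℝ :=
  w₁ z.1 - w₂ z.2 - g ‖z.1 - z.2‖

variable [InnerProductSpace ℝ E]

theorem hasFDerivAt_norm {z : E} (hz : z ≠ 0) :
    HasFDerivAt (fun x : E => ‖x‖) (innerSL ℝ (NormedSpace.normalize z)) z := by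
  have hsqrt := (hasStrictFDerivAt_norm_sq z).hasFDerivAt.sqrt (by simpa using hz)
  simp only [Real.sqrt_sq (norm_nonneg _)] at hsqrt
  refine hsqrt.congr_fderiv ?_
  ext ξ
  have hnorm : ‖z‖ ≠ 0 := norm_ne_zero_iff.2 hz
  simp only [NormedSpace.normalize, smul_apply, innerSL_apply_apply,
    real_inner_smul_left, smul_eq_mul, nsmul_eq_mul]
  field_simp
  norm_num

variable {w₁ w₂ : E → ℝ} {x y : E} {g g' : ℝ → ℝ}

theorem fderiv_eq_of_isLocalMax_doubling (hmax : IsLocalMax (doubling w₁ w₂ g) (x, y))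
    (hxy : x ≠ y) (hw₁ : DifferentiableAt ℝ w₁ x) (hw₂ : DifferentiableAt ℝ w₂ y) {q : ℝ}
    (hg : HasDerivAt g q ‖x - y‖) :
    fderiv ℝ w₁ x = innerSL ℝ (q • NormedSpace.normalize (x - y)) ∧
      fderiv ℝ w₂ y = innerSL ℝ (q • NormedSpace.normalize (x - y)) := by
  set e := NormedSpace.normalize (x - y)
  have hpenalty : HasFDerivAt (fun z : E × E => g ‖z.1 - z.2‖)
      (q • (innerSL ℝ e).comp (ContinuousLinearMap.fst ℝ E E - ContinuousLinearMap.snd ℝ E E))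
      (x, y) :=
    hg.comp_hasFDerivAt (x, y)
      ((hasFDerivAt_norm (sub_ne_zero.2 hxy)).comp (x, y) (hasFDerivAt_fst.sub hasFDerivAt_snd))
  have hzero := hmax.hasFDerivAt_eq_zero
    (((hw₁.hasFDerivAt.comp (x, y) hasFDerivAt_fst).sub
      (hw₂.hasFDerivAt.comp (x, y) hasFDerivAt_snd)).sub hpenalty)
  constructor <;> ext ξ
  · have := congr($hzero (ξ, 0))
    simpa [real_inner_smul_left, sub_eq_zero] using this
  · have := congr($hzero (0, ξ))
    simpa [neg_add_eq_zero] using this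

theorem eventually_norm_add_smul_sub_add_smul (hxy : x ≠ y) {τ : ℝ} {ξ η : E}
    (hτ : ξ - η = τ • NormedSpace.normalize (x - y)) :
    ∀ᶠ s : ℝ in 𝓝 0, ‖x + s • ξ - (y + s • η)‖ = ‖x - y‖ + s * τ := by
  have hnear : Tendsto (fun s : ℝ => ‖x - y‖ + s * τ) (𝓝 0) (𝓝 ‖x - y‖) := by
    simpa using (hasDerivAt_add_smul ‖x - y‖ τ 0).continuousAt.tendsto
  filter_upwards [hnear.eventually_const_le (norm_pos_iff.2 (sub_ne_zero.2 hxy))] with s hs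
  have hmove : x + s • ξ - (y + s • η) = (‖x - y‖ + s * τ) • NormedSpace.normalize (x - y) := by
    rw [add_smul, NormedSpace.norm_smul_normalize, mul_smul, ← hτ]
    module
  rw [hmove, norm_smul, Real.norm_of_nonneg hs,
    NormedSpace.norm_normalize (sub_ne_zero.2 hxy), mul_one]

theorem isLocalMax_doubling_comp_add_smul (hmax : IsLocalMax (doubling w₁ w₂ g) (x, y))
    (hxy : x ≠ y) {τ : ℝ} {ξ η : E} (hτ : ξ - η = τ • NormedSpace.normalize (x - y)) :
    IsLocalMax
      (fun s : ℝ => w₁ (x + s • ξ) - w₂ (y + s • η) - g (‖x - y‖ + s * τ)) 0 := by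
  have hpair : Tendsto (fun s : ℝ => (x + s • ξ, y + s • η)) (𝓝 0) (𝓝 (x, y)) := by
    simpa using ((hasDerivAt_add_smul x ξ 0).continuousAt.prodMk
      (hasDerivAt_add_smul y η 0).continuousAt).tendsto
  filter_upwards [hpair.eventually hmax, eventually_norm_add_smul_sub_add_smul hxy hτ]
    with s hs hnorm
  simpa [doubling, hnorm] using hs

theorem fderiv_fderiv_sub_le_of_isLocalMax_doubling
    (hmax : IsLocalMax (doubling w₁ w₂ g) (x, y)) (hxy : x ≠ y) (hw₁ : ContDiffAt ℝ 2 w₁ x)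
    (hw₂ : ContDiffAt ℝ 2 w₂ y) (hg : ∀ᶠ t in 𝓝 ‖x - y‖, HasDerivAt g (g' t) t) {g'' : ℝ}
    (hg' : HasDerivAt g' g'' ‖x - y‖) {τ : ℝ} {ξ η : E}
    (hτ : ξ - η = τ • NormedSpace.normalize (x - y)) :
    fderiv ℝ (fderiv ℝ w₁) x ξ ξ - fderiv ℝ (fderiv ℝ w₂) y η η ≤ g'' * τ ^ 2 := by
  have hdist : ∀ s : ℝ, HasDerivAt (fun s : ℝ => ‖x - y‖ + s * τ) τ s := fun s => by
    simpa using hasDerivAt_add_smul ‖x - y‖ τ s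
  have hnear : Tendsto (fun s : ℝ => ‖x - y‖ + s * τ) (𝓝 0) (𝓝 ‖x - y‖) := by
    simpa using (hdist 0).continuousAt.tendsto
  have hderiv := hasDerivAt_deriv_nonpos_of_isLocalMax
    (isLocalMax_doubling_comp_add_smul hmax hxy hτ)
    (f' := fun s => fderiv ℝ w₁ (x + s • ξ) ξ - fderiv ℝ w₂ (y + s • η) η
      - g' (‖x - y‖ + s * τ) * τ)
    (by
      filter_upwards [eventually_hasDerivAt_comp_add_smul hw₁ ξ,
        eventually_hasDerivAt_comp_add_smul hw₂ η, hnear.eventually hg] with s h₁ h₂ h₃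
      exact (h₁.sub h₂).sub (h₃.comp s (hdist s)))
    (((hasDerivAt_fderiv_comp_add_smul hw₁ ξ).sub
      (hasDerivAt_fderiv_comp_add_smul hw₂ η)).sub
        ((HasDerivAt.comp (0 : ℝ) (by simpa using hg') (hdist 0)).mul_const τ))
  linarith

end Doubling

section LogBarrier

variable {E : Type*}

/-- The convex increasing reparametrization `-log (c - u)` of a function `u < c`. The square of the
gradient in its second derivative is the good term of the gradient estimate. -/
noncomputable def logBarrier (c : ℝ) (u : E → ℝ) (z : E) : ℝ :=
  -Real.log (c - u z)

theorem logBarrier_sub_le_log {u : E → ℝ} {M : ℝ} {x y : E} (hx : |u x| ≤ M) (hy : |u y| ≤ M) :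
    logBarrier (M + 1) u x - logBarrier (M + 1) u y ≤ Real.log (2 * M + 1) := by
  obtain ⟨-, hx⟩ := abs_le.1 hx
  obtain ⟨hy, hy'⟩ := abs_le.1 hy
  have hlog_x : 0 ≤ Real.log (M + 1 - u x) := Real.log_nonneg (by linarith)
  have hlog_y : Real.log (M + 1 - u y) ≤ Real.log (2 * M + 1) :=
    Real.log_le_log (by linarith) (by linarith)
  unfold logBarrier
  linarith

variable [NormedAddCommGroup E] [NormedSpace ℝ E] {u : E → ℝ} {c : ℝ} {z : E}

theorem contDiffAt_logBarrier {k : WithTop ℕ∞} (hu : ContDiffAt ℝ k u z) (hc : u z < c) :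
    ContDiffAt ℝ k (logBarrier c u) z :=
  ((contDiffAt_const.sub hu).log (sub_pos.2 hc).ne').neg

theorem fderiv_logBarrier (hu : DifferentiableAt ℝ u z) (hc : u z < c) :
    fderiv ℝ (logBarrier c u) z = (c - u z)⁻¹ • fderiv ℝ u z := by
  refine ((hu.hasFDerivAt.const_sub c).log (sub_pos.2 hc).ne').fun_neg.fderiv.trans ?_
  rw [smul_neg, neg_neg]

theorem fderiv_fderiv_logBarrier (hu : ContDiffAt ℝ 2 u z) (hc : u z < c) (ξ : E) :
    fderiv ℝ (fderiv ℝ (logBarrier c u)) z ξ ξ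
      = (c - u z)⁻¹ * fderiv ℝ (fderiv ℝ u) z ξ ξ + fderiv ℝ (logBarrier c u) z ξ ^ 2 := by
  have hfirst : fderiv ℝ (logBarrier c u) =ᶠ[𝓝 z] fun y => (c - u y)⁻¹ • fderiv ℝ u y := by
    filter_upwards [hu.eventually (by simp), hu.continuousAt.eventually_lt_const hc] with y hy hcy
    exact fderiv_logBarrier (hy.differentiableAt (by simp)) hcy
  have hinv : HasFDerivAt (fun y => (c - u y)⁻¹) ((c - u z)⁻¹ ^ 2 • fderiv ℝ u z) z := by
    have hdiff := (hu.differentiableAt (by simp)).hasFDerivAt.const_sub c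
    simpa [Function.comp_def] using (hasDerivAt_inv (sub_pos.2 hc).ne').comp_hasFDerivAt z hdiff
  have hsecond := hinv.fun_smul
    ((hu.fderiv_right (m := 1) le_rfl).differentiableAt (by simp)).hasFDerivAt
  rw [hfirst.fderiv_eq, hsecond.fderiv, hfirst.self_of_nhds]
  simp only [add_apply, smul_apply, ContinuousLinearMap.smulRight_apply, smul_eq_mul]
  ring

theorem norm_fderiv_le_of_eventually_sub_le {w : E → ℝ} {L : ℝ} (hw : DifferentiableAt ℝ w z)
    (hL : 0 ≤ L) (hlip : ∀ᶠ y in 𝓝 z, w z - w y ≤ L * ‖z - y‖) : ‖fderiv ℝ w z‖ ≤ L := by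
  have hdir : ∀ ξ, -fderiv ℝ w z ξ ≤ L * ‖ξ‖ := fun ξ => by
    have hslope := (hw.hasFDerivAt.hasLineDerivAt ξ).tendsto_slope_zero_right
    have hline : Tendsto (fun s : ℝ => z + s • ξ) (𝓝[>] 0) (𝓝 z) := by
      simpa using (hasDerivAt_add_smul z ξ 0).continuousAt.tendsto.mono_left nhdsWithin_le_nhds
    refine neg_le.2 (ge_of_tendsto hslope ?_)
    filter_upwards [hline.eventually hlip, self_mem_nhdsWithin] with s hs hs₀
    have hs₀ : 0 < s := hs₀
    rw [sub_add_cancel_left, norm_neg, norm_smul, Real.norm_of_nonneg hs₀.le] at hs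
    rw [smul_eq_mul, ← div_eq_inv_mul, le_div_iff₀ hs₀]
    linarith
  refine ContinuousLinearMap.opNorm_le_bound _ hL fun ξ => abs_le.2 ⟨?_, ?_⟩
  · exact neg_le.1 (hdir ξ)
  · simpa using hdir (-ξ)

theorem norm_fderiv_le_of_logBarrier {L : ℝ} (hu : DifferentiableAt ℝ u z) (hc : u z < c)
    (hL : ‖fderiv ℝ (logBarrier c u) z‖ ≤ L) : ‖fderiv ℝ u z‖ ≤ (c - u z) * L := by
  have hpos := sub_pos.2 hc
  rwa [fderiv_logBarrier hu hc, norm_smul, Real.norm_of_nonneg (inv_nonneg.2 hpos.le),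
    inv_mul_le_iff₀ hpos] at hL

end LogBarrier

section Localization

variable {E : Type*} [NormedAddCommGroup E] [InnerProductSpace ℝ E] {w : E → ℝ} {x : E}

theorem fderiv_sub_mul_norm_sub_sq (hw : DifferentiableAt ℝ w x) (B : ℝ) (x₀ : E) :
    fderiv ℝ (fun z => w z - B * ‖z - x₀‖ ^ 2) x
      = fderiv ℝ w x - innerSL ℝ ((2 * B) • (x - x₀)) := by
  rw [(hw.hasFDerivAt.fun_sub
    ((hasFDerivAt_sub_const x₀).norm_sq.const_mul B)).fderiv]
  ext ξ
  simp only [ContinuousLinearMap.comp_id, sub_apply, smul_apply, coe_innerSL_apply, nsmul_eq_mul,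
    Nat.cast_ofNat, smul_eq_mul, map_smul]
  ring

theorem fderiv_fderiv_sub_mul_norm_sub_sq (hw : ContDiffAt ℝ 2 w x) (B : ℝ) (x₀ ξ : E) :
    fderiv ℝ (fderiv ℝ fun z => w z - B * ‖z - x₀‖ ^ 2) x ξ ξ
      = fderiv ℝ (fderiv ℝ w) x ξ ξ - 2 * B * ‖ξ‖ ^ 2 := by
  have hfirst : (fderiv ℝ fun z => w z - B * ‖z - x₀‖ ^ 2)
      =ᶠ[𝓝 x] fun z => fderiv ℝ w z - innerSL ℝ ((2 * B) • (z - x₀)) := by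
    filter_upwards [hw.eventually (by simp)] with y hy
    exact fderiv_sub_mul_norm_sub_sq (hy.differentiableAt (by simp)) B x₀
  have hinner : HasFDerivAt (fun z => innerSL ℝ ((2 * B) • (z - x₀)))
      ((innerSL ℝ).comp ((2 * B) • ContinuousLinearMap.id ℝ E)) x :=
    (innerSL ℝ).hasFDerivAt.comp x ((hasFDerivAt_sub_const x₀).const_smul (2 * B))
  have hfderiv := ((hw.fderiv_right (m := 1) le_rfl).differentiableAt (by simp)).hasFDerivAt
  rw [hfirst.fderiv_eq, (hfderiv.fun_sub hinner).fderiv]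
  have hquad : innerSL ℝ ((2 * B) • ξ) ξ = 2 * B * ‖ξ‖ ^ 2 := by
    rw [innerSL_apply_apply, real_inner_smul_left, real_inner_self_eq_norm_sq]
  exact congr(_ - $hquad)

theorem doublingComparison_of_isLocalMax {u : E → ℝ} {c B F : ℝ} {x₀ y : E} {g g' : ℝ → ℝ}
    (hmax : IsLocalMax
      (doubling (fun z => logBarrier c u z - B * ‖z - x₀‖ ^ 2) (logBarrier c u) g) (x, y))
    (hxy : x ≠ y) (hux : ContDiffAt ℝ 2 u x) (huy : ContDiffAt ℝ 2 u y) (hcx : u x < c)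
    (hcy : u y < c) (hg : ∀ᶠ t in 𝓝 ‖x - y‖, HasDerivAt g (g' t) t)
    (hg' : HasDerivAt g' (-F) ‖x - y‖) :
    DoublingComparison (fun ξ => (c - u x)⁻¹ * fderiv ℝ (fderiv ℝ u) x ξ ξ)
      (fun η => (c - u y)⁻¹ * fderiv ℝ (fderiv ℝ u) y η η) (NormedSpace.normalize (x - y))
      ((2 * B) • (x - x₀)) (g' ‖x - y‖) F B := by
  intro τ ξ η hτ
  have hwx := contDiffAt_logBarrier hux hcx
  have hwy := contDiffAt_logBarrier huy hcy
  have hwBx : ContDiffAt ℝ 2 (fun z => logBarrier c u z - B * ‖z - x₀‖ ^ 2) x :=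
    hwx.sub (contDiffAt_const.mul ((contDiffAt_id.sub contDiffAt_const).norm_sq ℝ))
  obtain ⟨hgradx, hgrady⟩ := fderiv_eq_of_isLocalMax_doubling hmax hxy
    (hwBx.differentiableAt (by simp)) (hwy.differentiableAt (by simp)) hg.self_of_nhds
  rw [fderiv_sub_mul_norm_sub_sq (hwx.differentiableAt (by simp)), sub_eq_iff_eq_add,
    ← map_add] at hgradx
  have hsecond := fderiv_fderiv_sub_le_of_isLocalMax_doubling hmax hxy hwBx hwy hg hg' hτ
  rw [fderiv_fderiv_sub_mul_norm_sub_sq hwx, fderiv_fderiv_logBarrier hux hcx,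
    fderiv_fderiv_logBarrier huy hcy, hgradx, hgrady, innerSL_apply_apply,
    innerSL_apply_apply] at hsecond
  linarith

end Localization

section Operator

variable {n p : ℕ}

theorem quadForm_hessian (u : EuclideanSpace ℝ (Fin n) → ℝ) (x ξ : EuclideanSpace ℝ (Fin n)) :
    quadForm (hessian u x) ξ = fderiv ℝ (fderiv ℝ u) x ξ ξ := by
  conv_rhs => rw [← (EuclideanSpace.basisFun (Fin n) ℝ).sum_repr ξ]
  simp only [quadForm_eq_sum, hessian, Matrix.of_apply, EuclideanSpace.basisFun_repr,
    EuclideanSpace.basisFun_apply, map_sum, map_smul, sum_apply, smul_apply, smul_eq_mul,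
    Finset.mul_sum]
  rw [Finset.sum_comm]
  exact Finset.sum_congr rfl fun i _ => Finset.sum_congr rfl fun j _ => by ring

theorem le_mpMatrix (hpn : p ≤ n) {A : Matrix (Fin n) (Fin n) ℝ} (hA : A.IsHermitian) {k : ℝ}
    (hk : 1 ≤ k) (hsum : ∀ s : Finset (Fin n), s.card = p → k ≤ ∑ i ∈ s, hA.eigenvalues i) :
    k ≤ mpMatrix p A := by
  have hcard : ((Finset.univ : Finset (Fin n)).powersetCard p).card ≠ 0 := by
    simpa using (Nat.choose_pos hpn).ne'
  rw [mpMatrix, dif_pos hA]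
  calc k ≤ k ^ ((Finset.univ : Finset (Fin n)).powersetCard p).card := le_self_pow₀ hk hcard
    _ = ∏ _s ∈ (Finset.univ : Finset (Fin n)).powersetCard p, k := (Finset.prod_const k).symm
    _ ≤ _ := Finset.prod_le_prod (fun _ _ => zero_le_one.trans hk) fun s hs =>
      hsum s (Finset.mem_powersetCard.1 hs).2

theorem le_mpOperator_of_isLocalMax (hp : p ≠ 0) (hpn : p ≤ n)
    {u : EuclideanSpace ℝ (Fin n) → ℝ} {c B F k : ℝ} {x₀ x y : EuclideanSpace ℝ (Fin n)}
    {g g' : ℝ → ℝ} (hux : ContDiffAt ℝ 2 u x) (huy : ContDiffAt ℝ 2 u y) (hcx : u x < c)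
    (hcy : u y + 1 ≤ c) (hA : hessian u x ∈ closure (pCone n p))
    (hH : (hessian u y).IsHermitian)
    (hmax : IsLocalMax
      (doubling (fun z => logBarrier c u z - B * ‖z - x₀‖ ^ 2) (logBarrier c u) g) (x, y))
    (hxy : x ≠ y) (hg : ∀ᶠ t in 𝓝 ‖x - y‖, HasDerivAt g (g' t) t)
    (hg' : HasDerivAt g' (-F) ‖x - y‖) (hq : 0 ≤ g' ‖x - y‖) (hF : 0 ≤ F) (hk : 1 ≤ k)
    (hkF : k + 2 * p * (g' ‖x - y‖ * ‖(2 * B) • (x - x₀)‖ + B) ≤ 2 * F / p)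
    (hkq : k + (2 * p + 1) * (g' ‖x - y‖ * ‖(2 * B) • (x - x₀)‖ + B) ≤ g' ‖x - y‖ ^ 2 / 2) :
    k ≤ mpOperator p u y := by
  have hcmp := doublingComparison_of_isLocalMax hmax hxy hux huy hcx (by linarith) hg hg'
  simp only [← quadForm_hessian] at hcmp
  refine le_mpMatrix hpn hH hk fun s hs => ?_
  have hv : Orthonormal ℝ fun i : s => hH.eigenvectorBasis i :=
    hH.eigenvectorBasis.orthonormal.comp _ Subtype.val_injective
  have hle := hcmp.le_sum_of_mem_closure_pCone hp hpn hA (inv_nonneg.2 (sub_pos.2 hcx).le) hq hF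
    (NormedSpace.norm_normalize (sub_ne_zero.2 hxy)) (by simp [quadForm]) hv (by simpa using hs)
    hkF hkq
  simp only [quadForm_eigenvectorBasis, ← Finset.mul_sum] at hle
  rw [Finset.sum_coe_sort s hH.eigenvalues, ← div_eq_inv_mul, le_div_iff₀ (by linarith)] at hle
  exact (le_mul_of_one_le_right (by linarith) (by linarith)).trans hle

end Operator

section InteriorMaximum

variable {E : Type*} [NormedAddCommGroup E]

theorem continuousOn_doubling {w₁ w₂ : E → ℝ} {g : ℝ → ℝ} {s : Set E} (hw₁ : ContinuousOn w₁ s)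
    (hw₂ : ContinuousOn w₂ s) (hg : Continuous g) :
    ContinuousOn (doubling w₁ w₂ g) (s ×ˢ s) :=
  ((hw₁.comp continuousOn_fst fun _ hz => hz.1).sub
    (hw₂.comp continuousOn_snd fun _ hz => hz.2)).sub
      (hg.comp (continuous_fst.sub continuous_snd).norm).continuousOn

theorem norm_snd_sub_le {x₀ : E} {z : E × E} {ρ δ : ℝ} (hz : ‖z.1 - x₀‖ ≤ ρ ∧ ‖z.1 - z.2‖ ≤ δ) :
    ‖z.2 - x₀‖ ≤ ρ + δ := by
  have htri := norm_sub_le_norm_sub_add_norm_sub z.2 z.1 x₀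
  rw [norm_sub_rev z.2 z.1] at htri
  linarith [hz.1, hz.2]

theorem isCompact_setOf_norm_sub_le [ProperSpace E] (x₀ : E) (ρ δ : ℝ) :
    IsCompact {z : E × E | ‖z.1 - x₀‖ ≤ ρ ∧ ‖z.1 - z.2‖ ≤ δ} := by
  refine ((isCompact_closedBall x₀ ρ).prod (isCompact_closedBall x₀ (ρ + δ))).of_isClosed_subset
    ?_ fun z hz => ⟨mem_closedBall_iff_norm.2 hz.1, mem_closedBall_iff_norm.2 (norm_snd_sub_le hz)⟩
  exact (isClosed_le (continuous_fst.sub continuous_const).norm continuous_const).inter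
    (isClosed_le (continuous_fst.sub continuous_snd).norm continuous_const)

theorem exists_isLocalMax_doubling [ProperSpace E] {w : E → ℝ} {x₀ y₀ : E} {g : ℝ → ℝ}
    {r ρ δ m B : ℝ} (hw : ContinuousOn w (ball x₀ r))
    (hosc : ∀ x ∈ ball x₀ r, ∀ y ∈ ball x₀ r, w x - w y ≤ m) (hρ : 0 ≤ ρ) (hδ : 0 ≤ δ)
    (hr : ρ + δ < r) (hB : 0 ≤ B) (hBρ : m ≤ B * ρ ^ 2) (hg : Continuous g)
    (hg₀ : ∀ t ∈ Set.Icc 0 δ, 0 ≤ g t) (hgδ : m ≤ g δ) (hy₀ : ‖x₀ - y₀‖ ≤ δ)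
    (hpos : 0 < doubling (fun z => w z - B * ‖z - x₀‖ ^ 2) w g (x₀, y₀)) :
    ∃ x y, ‖x - x₀‖ < ρ ∧ ‖x - y‖ < δ ∧ x ≠ y ∧
      IsLocalMax (doubling (fun z => w z - B * ‖z - x₀‖ ^ 2) w g) (x, y) := by
  set T : Set (E × E) := {z | ‖z.1 - x₀‖ ≤ ρ ∧ ‖z.1 - z.2‖ ≤ δ}
  set S : Set (E × E) := {z | ‖z.1 - x₀‖ < ρ ∧ ‖z.1 - z.2‖ < δ ∧ z.1 ≠ z.2}
  have hball : T ⊆ ball x₀ r ×ˢ ball x₀ r := fun z hz =>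
    ⟨mem_ball_iff_norm.2 (by linarith [hz.1]),
      mem_ball_iff_norm.2 ((norm_snd_sub_le hz).trans_lt hr)⟩
  have hS : IsOpen S :=
    (isOpen_lt (continuous_fst.sub continuous_const).norm continuous_const).inter
      ((isOpen_lt (continuous_fst.sub continuous_snd).norm continuous_const).inter
        (isOpen_ne_fun continuous_fst continuous_snd))
  have hcont : ContinuousOn (doubling (fun z => w z - B * ‖z - x₀‖ ^ 2) w g) T :=
    (continuousOn_doubling (hw.sub (by fun_prop)) hw hg).mono hball
  have hboundary : ∀ z ∈ T \ S, doubling (fun z => w z - B * ‖z - x₀‖ ^ 2) w g z ≤ 0 := by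
    rintro z ⟨hzT, hzS⟩
    have hosc_z := hosc _ (hball hzT).1 _ (hball hzT).2
    have hg_z := hg₀ ‖z.1 - z.2‖ ⟨norm_nonneg _, hzT.2⟩
    have hB_z : 0 ≤ B * ‖z.1 - x₀‖ ^ 2 := by positivity
    simp only [doubling]
    rcases hzT.1.lt_or_eq with hz₁ | hz₁
    · rcases hzT.2.lt_or_eq with hz₂ | hz₂
      · have hdiag : z.1 = z.2 := by_contra fun hne => hzS ⟨hz₁, hz₂, hne⟩
        rw [← hdiag] at hg_z ⊢
        linarith
      · rw [hz₂]
        linarith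
    · rw [hz₁]
      linarith
  obtain ⟨⟨x, y⟩, ⟨hx, hxy, hne⟩, hmax⟩ :=
    (isCompact_setOf_norm_sub_le x₀ ρ δ).exists_isLocalMax_mem_open
      (fun z hz => ⟨hz.1.le, hz.2.1.le⟩) hcont (z := (x₀, y₀)) ⟨by simpa using hρ, hy₀⟩
      (fun z hz => (hboundary z hz).trans_lt hpos) hS
  exact ⟨x, y, hx, hxy, hne, hmax⟩

end InteriorMaximum

section Penalty

/-- A concave modulus of continuity with slope `L` at `0`. It is increasing on `[0, 2 * m / L]` and
exceeds the oscillation bound `m` at the end of this interval. -/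
noncomputable def penalty (m L t : ℝ) : ℝ :=
  L * t - (L * t) ^ 2 / (8 * m)

variable {m L t : ℝ}

theorem hasDerivAt_penalty (m L t : ℝ) :
    HasDerivAt (penalty m L) (L - L ^ 2 / (4 * m) * t) t := by
  have hlin : HasDerivAt (fun t : ℝ => L * t) L t := by
    simpa using (hasDerivAt_id t).const_mul L
  refine (hlin.sub ((hlin.pow 2).div_const (8 * m))).congr_deriv ?_
  push_cast
  ring

theorem slope_penalty_mem_Icc (hm : 0 < m) (hL : 0 < L) (ht : t ∈ Set.Icc 0 (2 * m / L)) :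
    L - L ^ 2 / (4 * m) * t ∈ Set.Icc (L / 2) L := by
  have hfull : L ^ 2 / (4 * m) * (2 * m / L) = L / 2 := by
    field_simp
    norm_num
  have hcoeff : 0 ≤ L ^ 2 / (4 * m) := by positivity
  have hslope := mul_le_mul_of_nonneg_left ht.2 hcoeff
  constructor <;> linarith [mul_nonneg hcoeff ht.1]

theorem penalty_nonneg (hm : 0 < m) (hL : 0 < L) (ht : t ∈ Set.Icc 0 (2 * m / L)) :
    0 ≤ penalty m L t := by
  have hLt : 0 ≤ L * t := mul_nonneg hL.le ht.1
  have hLt' : t * L ≤ 2 * m := (le_div_iff₀ hL).1 ht.2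
  have hquad : (L * t) ^ 2 / (8 * m) ≤ L * t := by
    rw [div_le_iff₀ (by positivity), sq]
    exact mul_le_mul_of_nonneg_left (by linarith) hLt
  exact sub_nonneg.2 hquad

theorem penalty_le (hm : 0 ≤ m) : penalty m L t ≤ L * t :=
  sub_le_self _ (by positivity)

theorem penalty_two_mul_div (hm : m ≠ 0) (hL : L ≠ 0) : penalty m L (2 * m / L) = 3 / 2 * m := by
  unfold penalty
  field_simp
  norm_num

theorem eventually_add_mul_le_mul_sq (a b : ℝ) {ε : ℝ} (hε : 0 < ε) :
    ∀ᶠ L : ℝ in atTop, a + b * L ≤ ε * L ^ 2 := by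
  have htop : Tendsto (fun L : ℝ => L * (ε * L + -b)) atTop atTop :=
    tendsto_id.atTop_mul_atTop₀
      (tendsto_atTop_add_const_right _ _ (tendsto_id.const_mul_atTop hε))
  filter_upwards [htop.eventually_ge_atTop a] with L hL
  linarith

end Penalty

section GradientEstimate

variable {n p : ℕ}

theorem le_mpOperator_of_isLocalMax_penalty (hp : p ≠ 0) (hpn : p ≤ n)
    {u : EuclideanSpace ℝ (Fin n) → ℝ} {x₀ x y : EuclideanSpace ℝ (Fin n)} {c r m L k : ℝ}
    (hux : ContDiffAt ℝ 2 u x) (huy : ContDiffAt ℝ 2 u y) (hcx : u x < c) (hcy : u y + 1 ≤ c)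
    (hA : hessian u x ∈ closure (pCone n p)) (hH : (hessian u y).IsHermitian)
    (hmax : IsLocalMax (doubling (fun z => logBarrier c u z - 4 * m / r ^ 2 * ‖z - x₀‖ ^ 2)
      (logBarrier c u) (penalty m L)) (x, y))
    (hne : x ≠ y) (hx : ‖x - x₀‖ ≤ r / 2) (hxy : ‖x - y‖ ≤ 2 * m / L) (hr : 0 < r) (hm : 1 ≤ m)
    (hL : 0 < L) (hk : 1 ≤ k)
    (hLk : k + (2 * p + 1) * (L * (4 * m / r) + 4 * m / r ^ 2) ≤ L ^ 2 / (8 * m * p)) :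
    k ≤ mpOperator p u y := by
  have hm₀ : 0 < m := by linarith
  have hp₁ : (1 : ℝ) ≤ p := by exact_mod_cast Nat.one_le_iff_ne_zero.2 hp
  set q := L - L ^ 2 / (4 * m) * ‖x - y‖
  obtain ⟨hq_lower, hq_upper⟩ : q ∈ Set.Icc (L / 2) L :=
    slope_penalty_mem_Icc hm₀ hL ⟨norm_nonneg _, hxy⟩
  have hgrad : ‖(2 * (4 * m / r ^ 2)) • (x - x₀)‖ ≤ 4 * m / r := by
    rw [norm_smul, Real.norm_of_nonneg (by positivity)]
    calc 2 * (4 * m / r ^ 2) * ‖x - x₀‖ ≤ 2 * (4 * m / r ^ 2) * (r / 2) := by gcongr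
      _ = 4 * m / r := by field_simp
  have herror : q * ‖(2 * (4 * m / r ^ 2)) • (x - x₀)‖ + 4 * m / r ^ 2
      ≤ L * (4 * m / r) + 4 * m / r ^ 2 := by gcongr
  have herror_nonneg : 0 ≤ q * ‖(2 * (4 * m / r ^ 2)) • (x - x₀)‖ + 4 * m / r ^ 2 := by
    have : 0 ≤ q := by linarith
    positivity
  have hlarge := (add_le_add_right
    (mul_le_mul_of_nonneg_left herror (by positivity : (0 : ℝ) ≤ 2 * p + 1)) k).trans hLk
  have hslope : L ^ 2 / (8 * m * p) ≤ q ^ 2 / 2 := by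
    calc L ^ 2 / (8 * m * p) ≤ L ^ 2 / (8 * 1 * 1) := by gcongr
      _ = (L / 2) ^ 2 / 2 := by ring
      _ ≤ q ^ 2 / 2 := by gcongr
  have hconcave : L ^ 2 / (8 * m * p) ≤ 2 * (L ^ 2 / (4 * m)) / p := by
    rw [show 2 * (L ^ 2 / (4 * m)) / p = 4 * (L ^ 2 / (8 * m * p)) by field_simp; norm_num]
    linarith [show 0 ≤ L ^ 2 / (8 * m * p) by positivity]
  have hslope_deriv :
      HasDerivAt (fun t => L - L ^ 2 / (4 * m) * t) (-(L ^ 2 / (4 * m))) ‖x - y‖ := by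
    simpa using ((hasDerivAt_id ‖x - y‖).const_mul (L ^ 2 / (4 * m))).const_sub L
  exact le_mpOperator_of_isLocalMax hp hpn hux huy hcx hcy hA hH hmax hne
    (.of_forall (hasDerivAt_penalty m L)) hslope_deriv (by linarith) (by positivity) hk
    (by linarith) (by linarith)

theorem logBarrier_sub_le_penalty (hp : p ≠ 0) (hpn : p ≤ n)
    {u : EuclideanSpace ℝ (Fin n) → ℝ} {x₀ y₀ : EuclideanSpace ℝ (Fin n)} {r c m L k : ℝ}
    (hu : IsPPlurisubharmonicOn p u (ball x₀ r)) (hc : ∀ x ∈ ball x₀ r, u x + 1 ≤ c)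
    (hosc : ∀ x ∈ ball x₀ r, ∀ y ∈ ball x₀ r, logBarrier c u x - logBarrier c u y ≤ m)
    (hop : ∀ x ∈ ball x₀ r, mpOperator p u x < k) (hr : 0 < r) (hm : 1 ≤ m) (hL : 0 < L)
    (hk : 1 ≤ k) (hLr : 8 * m / L < r)
    (hLk : k + (2 * p + 1) * (L * (4 * m / r) + 4 * m / r ^ 2) ≤ L ^ 2 / (8 * m * p))
    (hy₀ : ‖x₀ - y₀‖ ≤ 2 * m / L) :
    logBarrier c u x₀ - logBarrier c u y₀ ≤ penalty m L ‖x₀ - y₀‖ := by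
  have hm₀ : 0 < m := by linarith
  have hregular : ∀ x ∈ ball x₀ r, ContDiffAt ℝ 2 u x := fun x hx =>
    hu.contDiffOn.contDiffAt (isOpen_ball.mem_nhds hx)
  have hbelow : ∀ x ∈ ball x₀ r, u x < c := fun x hx => by linarith [hc x hx]
  have hradii : r / 2 + 2 * m / L < r := by
    linarith [show 2 * m / L = 8 * m / L / 4 by ring]
  by_contra! hpos
  obtain ⟨x, y, hx, hxy, hne, hmax⟩ := exists_isLocalMax_doubling (x₀ := x₀) (y₀ := y₀)
    (r := r) (ρ := r / 2) (δ := 2 * m / L) (B := 4 * m / r ^ 2) (g := penalty m L)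
    (fun x hx => (contDiffAt_logBarrier (hregular x hx)
      (hbelow x hx)).continuousAt.continuousWithinAt) hosc (by positivity) (by positivity)
    hradii (by positivity)
    (by field_simp; norm_num)
    (continuous_iff_continuousAt.2 fun t => (hasDerivAt_penalty m L t).continuousAt)
    (fun t ht => penalty_nonneg hm₀ hL ht)
    (by rw [penalty_two_mul_div hm₀.ne' hL.ne']; linarith) hy₀
    (by simpa [doubling] using hpos)
  have hx_ball : x ∈ ball x₀ r := mem_ball_iff_norm.2 (by linarith)
  have hy_ball : y ∈ ball x₀ r := mem_ball_iff_norm.2 <|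
    (norm_snd_sub_le (z := (x, y)) ⟨hx.le, hxy.le⟩).trans_lt hradii
  refine (hop y hy_ball).not_ge ?_
  exact le_mpOperator_of_isLocalMax_penalty hp hpn (hregular x hx_ball) (hregular y hy_ball)
    (hbelow x hx_ball) (hc y hy_ball) (hu.hessian_mem x hx_ball)
    (hessian_isHermitian isOpen_ball hu.contDiffOn hy_ball) hmax hne hx.le hxy.le hr hm hL hk hLk

theorem norm_gradient_le (hp : p ≠ 0) (hpn : p ≤ n) {u : EuclideanSpace ℝ (Fin n) → ℝ}
    {x₀ : EuclideanSpace ℝ (Fin n)} {r c m L k : ℝ}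
    (hu : IsPPlurisubharmonicOn p u (ball x₀ r)) (hc : ∀ x ∈ ball x₀ r, u x + 1 ≤ c)
    (hosc : ∀ x ∈ ball x₀ r, ∀ y ∈ ball x₀ r, logBarrier c u x - logBarrier c u y ≤ m)
    (hop : ∀ x ∈ ball x₀ r, mpOperator p u x < k) (hr : 0 < r) (hm : 1 ≤ m) (hL : 0 < L)
    (hk : 1 ≤ k) (hLr : 8 * m / L < r)
    (hLk : k + (2 * p + 1) * (L * (4 * m / r) + 4 * m / r ^ 2) ≤ L ^ 2 / (8 * m * p)) :
    ‖gradient u x₀‖ ≤ (c - u x₀) * L := by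
  have hx₀ := mem_ball_self hr (x := x₀)
  have hdiff : ContDiffAt ℝ 2 u x₀ := hu.contDiffOn.contDiffAt (isOpen_ball.mem_nhds hx₀)
  have hbelow : u x₀ < c := by linarith [hc x₀ hx₀]
  have hlip : ∀ᶠ y in 𝓝 x₀, logBarrier c u x₀ - logBarrier c u y ≤ L * ‖x₀ - y‖ := by
    filter_upwards [closedBall_mem_nhds x₀ (by positivity : 0 < 2 * m / L)] with y hy
    rw [mem_closedBall_iff_norm'] at hy
    exact (logBarrier_sub_le_penalty hp hpn hu hc hosc hop hr hm hL hk hLr hLk hy).trans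
      (penalty_le (by linarith))
  rw [gradient, LinearIsometryEquiv.norm_map]
  exact norm_fderiv_le_of_logBarrier (hdiff.differentiableAt (by simp)) hbelow <|
    norm_fderiv_le_of_eventually_sub_le
      ((contDiffAt_logBarrier hdiff hbelow).differentiableAt (by simp)) hL.le hlip

theorem exists_penalty_slope (hp : p ≠ 0) {r m : ℝ} (hr : 0 < r) (hm : 0 < m) (k : ℝ) :
    ∃ L : ℝ, 0 < L ∧ 8 * m / L < r ∧
      k + (2 * p + 1) * (L * (4 * m / r) + 4 * m / r ^ 2) ≤ L ^ 2 / (8 * m * p) := by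
  obtain ⟨L, hL₀, hLr, hLk⟩ := ((eventually_gt_atTop 0).and <|
    (eventually_gt_atTop (8 * m / r)).and <|
      eventually_add_mul_le_mul_sq (k + (2 * p + 1) * (4 * m / r ^ 2))
        ((2 * p + 1) * (4 * m / r)) (by positivity : 0 < 1 / (8 * m * p))).exists
  refine ⟨L, hL₀, (div_lt_comm₀ hr hL₀).1 hLr, ?_⟩
  calc k + (2 * p + 1) * (L * (4 * m / r) + 4 * m / r ^ 2)
      = k + (2 * p + 1) * (4 * m / r ^ 2) + (2 * p + 1) * (4 * m / r) * L := by ring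
    _ ≤ 1 / (8 * m * p) * L ^ 2 := hLk
    _ = L ^ 2 / (8 * m * p) := by ring

end GradientEstimate

theorem mainTheorem3_general (n p : ℕ) (hp : p ≠ 0) (hpn : p ≤ n) (r : ℝ) (hr : 0 < r)
    (M K : ℝ) :
    ∃ C : ℝ, ∀ (x₀ : EuclideanSpace ℝ (Fin n)) (u : EuclideanSpace ℝ (Fin n) → ℝ),
      IsPPlurisubharmonicOn p u (ball x₀ r) → (∀ x ∈ ball x₀ r, |u x| ≤ M) →
      (∀ x ∈ ball x₀ r, mpOperator p u x ≤ K) → ‖gradient u x₀‖ ≤ C := by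
  set m := max 1 (Real.log (2 * M + 1))
  set k := max 1 (K + 1)
  have hm : 1 ≤ m := le_max_left _ _
  obtain ⟨L, hL, hLr, hLk⟩ := exists_penalty_slope hp hr (zero_lt_one.trans_le hm) k
  refine ⟨(2 * M + 1) * L, fun x₀ u hu hM hK => ?_⟩
  have hgrad : ‖gradient u x₀‖ ≤ (M + 1 - u x₀) * L := by
    refine norm_gradient_le hp hpn hu (fun x hx => ?_) (fun x hx y hy => ?_) (fun x hx => ?_)
      hr hm hL (le_max_left _ _) hLr hLk
    · linarith [(abs_le.1 (hM x hx)).2]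
    · exact (logBarrier_sub_le_log (hM x hx) (hM y hy)).trans (le_max_right _ _)
    · exact (lt_add_one _).trans_le ((add_le_add_left (hK x hx) 1).trans (le_max_right _ _))
  refine hgrad.trans (mul_le_mul_of_nonneg_right ?_ hL.le)
  linarith [(abs_le.1 (hM x₀ (mem_ball_self hr))).1]

theorem mainTheorem3 (n p : ℕ) (hp : 1 < p) (hpn : p < n) (r : ℝ) (hr : 0 < r) (M K : ℝ) :
    ∃ C : ℝ, ∀ (x₀ : EuclideanSpace ℝ (Fin n)) (u : EuclideanSpace ℝ (Fin n) → ℝ)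
      (f : EuclideanSpace ℝ (Fin n) → ℝ → ℝ),
      IsPPlurisubharmonicOn p u (Metric.ball x₀ r) →
      ContDiffOn ℝ 3 u (Metric.ball x₀ r) →
      ContDiffOn ℝ 1 u (Metric.closedBall x₀ r) →
      (∀ x ∈ Metric.ball x₀ r, |u x| ≤ M) →
      (∀ x ∈ Metric.ball x₀ r, ∀ s : ℝ, 0 ≤ f x s) →
      HasLipschitzBound f (Metric.ball x₀ r) K →
      (∀ x ∈ Metric.ball x₀ r, mpOperator p u x = f x (u x)) →
      ‖gradient u x₀‖ ≤ C := by
  obtain ⟨C, hC⟩ := mainTheorem3_general n p (by lia) hpn.le r hr M K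
  exact ⟨C, fun x₀ u f hu _ _ hM _ hf heq => hC x₀ u hu hM fun x hx =>
    (heq x hx).trans_le ((le_abs_self _).trans (hf.bound x hx (u x)))⟩
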